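/- Let $S\subset\mathbb{R}^2$ be either the truncated parabola $P^1=\{(\xi,\xi^2):\ |\xi|\le 1/2\}$ or the unit circle $S^1=\{x\in\mathbb{R}^2:\ |x|=1\}$. For a finite set $\Lambda\subset\mathbb{R}^2$ let $$E_3(\Lambda)=\bigl|\{(\lambda_1,\ldots,\lambda_6)\in\Lambda^6:\ \lambda_1+\lambda_2+\lambda_3=\lambda_4+\lambda_5+\lambda_6\}\bigr|$$ be its $3$-energy. Then for every $\epsilon>0$ there is a constant $C_\epsilon>0$, depending only on $\epsilon$, such that for every finite set $\Lambda\subset S$ $$E_3(\Lambda)\le C_\epsilon\,|\Lambda|^{\frac72+\epsilon}.$$ -/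

import Mathlib

/-- The `k`-energy of a finite set `Λ ⊂ ℝⁿ`: the number of `2k`-tuples of elements of `Λ`,
written as pairs of `k`-tuples, whose two halves have the same sum. -/
noncomputable def kEnergy {n : ℕ} (k : ℕ) (Λ : Finset (EuclideanSpace ℝ (Fin n))) : ℕ :=
  Set.ncard {p : (Fin k → EuclideanSpace ℝ (Fin n)) × (Fin k → EuclideanSpace ℝ (Fin n)) |
    (∀ i, p.1 i ∈ Λ) ∧ (∀ i, p.2 i ∈ Λ) ∧ ∑ i, p.1 i = ∑ i, p.2 i}

/-- The truncated parabola `P¹ = {(ξ, ξ²) : |ξ| ≤ 1/2}` in the plane. -/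
def truncatedParabola : Set (EuclideanSpace ℝ (Fin 2)) :=
  {x | |x 0| ≤ 1 / 2 ∧ x 1 = x 0 ^ 2}

/-- The unit circle `S¹` in the plane. -/
def unitCircle : Set (EuclideanSpace ℝ (Fin 2)) :=
  Metric.sphere 0 1

open Finset

/-! The bound holds even with ε = 0. On the graph of a strictly convex `f`, let two different sorted
triples of abscissae have equal sums and equal `f`-sums. Neither majorizes the other, so their
smallest and largest entries move strictly in the same direction (`ends_eq_or_lt`). Cut the N
abscissae into blocks of q consecutive ones and colour a triple by the sum of the block indices of
its two ends. Restricting to equal colours costs, by Cauchy–Schwarz, a factor equal to the number of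
colours, about N/q. Both end indices move the same way, so equal colours force each end to stay in
its block: at most (Nq)² choices for the four ends. These fix the displacement between the middle
points, which is nonzero, and a strictly convex graph has only one chord with that displacement.
With q about √N the total is O(√N · N³).

The parabola is such a graph. The circle is two of them, glued by Cauchy–Schwarz for mixed energies
(`mixedEnergy_union_le`). -/

namespace ThreeEnergy

/-! ### Counting coincidences by Cauchy–Schwarz -/

section Coincidences

variable {α β γ δ : Type*}

open scoped Classical in
/-- The number of pairs in `P × R` on which the labels `φ` and `ψ` agree. -/
noncomputable def coincidences (P : Finset α) (φ : α → γ) (R : Finset β) (ψ : β → γ) : ℕ :=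
  #{p ∈ P ×ˢ R | φ p.1 = ψ p.2}

open scoped Classical in
theorem coincidences_eq_sum (P : Finset α) (φ : α → γ) (R : Finset β) (ψ : β → γ) (X : Finset γ)
    (hX : ∀ p ∈ P, φ p ∈ X) :
    coincidences P φ R ψ = ∑ x ∈ X, #{p ∈ P | φ p = x} * #{r ∈ R | ψ r = x} := by
  unfold coincidences
  rw [card_eq_sum_card_fiberwise (f := fun p : α × β => φ p.1) (t := X)]
  · refine sum_congr rfl fun x _ => ?_
    rw [← card_product]
    congr 1
    ext ⟨p, r⟩
    simp only [mem_filter, mem_product]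
    grind
  · intro p hp
    simp only [coe_filter, mem_product, Set.mem_ofPred_eq] at hp
    exact hX _ hp.1.1

theorem coincidences_sq_le (P : Finset α) (φ : α → γ) (R : Finset β) (ψ : β → γ) :
    coincidences P φ R ψ ^ 2 ≤ coincidences P φ P φ * coincidences R ψ R ψ := by
  classical
  have hP : ∀ p ∈ P, φ p ∈ P.image φ ∪ R.image ψ := fun p hp =>
    mem_union_left _ (mem_image_of_mem _ hp)
  have hR : ∀ p ∈ R, ψ p ∈ P.image φ ∪ R.image ψ := fun p hp =>
    mem_union_right _ (mem_image_of_mem _ hp)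
  rw [coincidences_eq_sum P φ R ψ _ hP, coincidences_eq_sum P φ P φ _ hP,
    coincidences_eq_sum R ψ R ψ _ hR]
  simp only [← sq]
  exact sum_mul_sq_le_sq_mul_sq _ _ _

/-- Refining the label by a colour taking values in `K` loses at most a factor `#K`. -/
theorem coincidences_le_card_mul (T : Finset α) (φ : α → γ) (c : α → δ) (K : Finset δ)
    (hK : ∀ p ∈ T, c p ∈ K) :
    coincidences T φ T φ ≤
      #K * coincidences T (fun p => (φ p, c p)) T (fun p => (φ p, c p)) := by
  classical
  rw [coincidences_eq_sum T φ T φ (T.image φ) fun p hp => mem_image_of_mem _ hp,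
    coincidences_eq_sum T (fun p => (φ p, c p)) T _ (T.image φ ×ˢ K) fun p hp =>
      mem_product.2 ⟨mem_image_of_mem _ hp, hK p hp⟩, sum_product, mul_sum]
  refine sum_le_sum fun x _ => ?_
  have h : #{p ∈ T | φ p = x} = ∑ k ∈ K, #{p ∈ T | (φ p, c p) = (x, k)} := by
    rw [card_eq_sum_card_fiberwise (f := c) (t := K)]
    · refine sum_congr rfl fun k _ => ?_
      rw [filter_filter]
      simp only [Prod.mk.injEq]
    · intro p hp
      exact hK p (mem_filter.1 hp).1
  rw [← sq, h]
  simp only [← sq]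
  -- Cauchy–Schwarz over the colours inside one fibre of `φ`.
  have hsq := sq_sum_le_card_mul_sum_sq (s := K) (f := fun k => #{p ∈ T | (φ p, c p) = (x, k)})
  rw [Nat.cast_id] at hsq
  refine hsq.trans_eq ?_
  congr!

end Coincidences

/-! ### Mixed energies and unions -/

section MixedEnergy

variable {G : Type*} [AddCommGroup G]

/-- The number of solutions of `∑ xᵢ = ∑ yᵢ` with `xᵢ, yᵢ ∈ C i`. -/
noncomputable def mixedEnergy (C : Fin 3 → Finset G) : ℕ :=
  coincidences (Fintype.piFinset C) (fun x => ∑ i, x i) (Fintype.piFinset C) fun x => ∑ i, x i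

theorem mixedEnergy_le_comp_perm (C : Fin 3 → Finset G) (σ : Equiv.Perm (Fin 3)) :
    mixedEnergy C ≤ mixedEnergy (C ∘ σ) := by
  classical
  refine card_le_card_of_injOn (fun p => (p.1 ∘ σ, p.2 ∘ σ)) ?_ ?_
  · rintro ⟨x, y⟩ h
    simp only [coe_filter, mem_product, Fintype.mem_piFinset, Set.mem_ofPred_eq,
      Function.comp_apply] at h ⊢
    exact ⟨⟨fun i => h.1.1 _, fun i => h.1.2 _⟩, by
      rw [Equiv.sum_comp σ x, Equiv.sum_comp σ y, h.2]⟩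
  · rintro ⟨x, y⟩ - ⟨x', y'⟩ - h
    simp only [Prod.mk.injEq] at h ⊢
    exact ⟨σ.surjective.injective_comp_right h.1, σ.surjective.injective_comp_right h.2⟩

/-- Rewrite the equation as x₀ - y₀ + x₁ = y₁ + y₂ - x₂ and apply Cauchy–Schwarz; moving the
negative terms across turns each factor back into a mixed energy. -/
theorem mixedEnergy_sq_le (A B C : Finset G) :
    mixedEnergy ![A, B, C] ^ 2 ≤ mixedEnergy ![A, A, B] * mixedEnergy ![B, C, C] := by
  classical
  have h := coincidences_sq_le (A ×ˢ A ×ˢ B) (fun p => p.1 - p.2.1 + p.2.2)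
    (B ×ˢ C ×ˢ C) (fun p => p.1 + p.2.1 - p.2.2)
  have e₀ : mixedEnergy ![A, B, C] ≤
      coincidences (A ×ˢ A ×ˢ B) (fun p => p.1 - p.2.1 + p.2.2)
        (B ×ˢ C ×ˢ C) (fun p => p.1 + p.2.1 - p.2.2) := by
    refine card_le_card_of_injOn
      (fun p => ((p.1 0, p.2 0, p.1 1), (p.2 1, p.2 2, p.1 2))) ?_ ?_
    · rintro ⟨x, y⟩ h
      simp only [coe_filter, mem_product, Fintype.mem_piFinset, Set.mem_ofPred_eq,
        Fin.forall_fin_succ, Fin.sum_univ_three] at h ⊢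
      simp at h ⊢
      refine ⟨by tauto, ?_⟩
      have := h.2
      rw [← sub_eq_zero] at this ⊢
      rw [← this]; abel
    · rintro ⟨x, y⟩ - ⟨x', y'⟩ - h
      simp only [Prod.mk.injEq] at h ⊢
      constructor <;> ext i <;> fin_cases i <;> simp <;> tauto
  have e₁ : coincidences (A ×ˢ A ×ˢ B) (fun p => p.1 - p.2.1 + p.2.2)
      (A ×ˢ A ×ˢ B) (fun p => p.1 - p.2.1 + p.2.2) ≤ mixedEnergy ![A, A, B] := by
    refine card_le_card_of_injOn
      (fun p => (![p.1.1, p.2.2.1, p.1.2.2], ![p.2.1, p.1.2.1, p.2.2.2])) ?_ ?_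
    · rintro ⟨⟨a, b, c⟩, ⟨a', b', c'⟩⟩ h
      simp only [coe_filter, mem_product, Fintype.mem_piFinset, Set.mem_ofPred_eq,
        Fin.forall_fin_succ, Fin.sum_univ_three] at h ⊢
      simp at h ⊢
      refine ⟨by tauto, ?_⟩
      have := h.2
      rw [← sub_eq_zero] at this ⊢
      rw [← this]; abel
    · rintro ⟨⟨a, b, c⟩, ⟨a', b', c'⟩⟩ - ⟨⟨x, y, z⟩, ⟨x', y', z'⟩⟩ - h
      simp at h ⊢
      tauto
  have e₂ : coincidences (B ×ˢ C ×ˢ C) (fun p => p.1 + p.2.1 - p.2.2)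
      (B ×ˢ C ×ˢ C) (fun p => p.1 + p.2.1 - p.2.2) ≤ mixedEnergy ![B, C, C] := by
    refine card_le_card_of_injOn
      (fun p => (![p.1.1, p.1.2.1, p.2.2.2], ![p.2.1, p.2.2.1, p.1.2.2])) ?_ ?_
    · rintro ⟨⟨a, b, c⟩, ⟨a', b', c'⟩⟩ h
      simp only [coe_filter, mem_product, Fintype.mem_piFinset, Set.mem_ofPred_eq,
        Fin.forall_fin_succ, Fin.sum_univ_three] at h ⊢
      simp at h ⊢
      refine ⟨by tauto, ?_⟩
      have := h.2
      rw [← sub_eq_zero] at this ⊢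
      rw [← this]; abel
    · rintro ⟨⟨a, b, c⟩, ⟨a', b', c'⟩⟩ - ⟨⟨x, y, z⟩, ⟨x', y', z'⟩⟩ - h
      simp at h ⊢
      tauto
  calc _ ≤ _ := Nat.pow_le_pow_left e₀ 2
    _ ≤ _ := h
    _ ≤ _ := Nat.mul_le_mul e₁ e₂

/-- With X, Y the two mixed energies and a, b the pure ones, X² ≤ aY and Y² ≤ Xb; cancelling the
larger of X, Y bounds it by a or b. -/
theorem mixedEnergy_two_one_le (A B : Finset G) :
    mixedEnergy ![A, A, B] ≤ mixedEnergy ![A, A, A] + mixedEnergy ![B, B, B] ∧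
      mixedEnergy ![A, B, B] ≤ mixedEnergy ![A, A, A] + mixedEnergy ![B, B, B] := by
  have hX := mixedEnergy_sq_le A A B
  have hY := mixedEnergy_sq_le A B B
  generalize mixedEnergy ![A, A, B] = X at *
  generalize mixedEnergy ![A, B, B] = Y at *
  generalize mixedEnergy ![A, A, A] = a at *
  generalize mixedEnergy ![B, B, B] = b at *
  have hmax : max X Y ≤ a + b := by
    rcases le_total X Y with h | h
    · rw [max_eq_right h]
      by_contra! hc
      nlinarith
    · rw [max_eq_left h]
      by_contra! hc
      nlinarith
  exact ⟨(le_max_left _ _).trans hmax, (le_max_right _ _).trans hmax⟩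

theorem mixedEnergy_ite_le (A B : Finset G) (P : Fin 3 → Bool) :
    mixedEnergy (fun i => if P i then A else B) ≤
      mixedEnergy ![A, A, A] + mixedEnergy ![B, B, B] := by
  obtain ⟨hX, hY⟩ := mixedEnergy_two_one_le A B
  have key : ∀ (σ : Equiv.Perm (Fin 3)) (D : Fin 3 → Finset G),
      (fun i => if P i then A else B) ∘ σ = D →
      mixedEnergy D ≤ mixedEnergy ![A, A, A] + mixedEnergy ![B, B, B] →
      mixedEnergy (fun i => if P i then A else B) ≤
        mixedEnergy ![A, A, A] + mixedEnergy ![B, B, B] := by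
    rintro σ D rfl h
    exact (mixedEnergy_le_comp_perm _ σ).trans h
  have hA : mixedEnergy ![A, A, A] ≤ mixedEnergy ![A, A, A] + mixedEnergy ![B, B, B] :=
    Nat.le_add_right _ _
  have hB : mixedEnergy ![B, B, B] ≤ mixedEnergy ![A, A, A] + mixedEnergy ![B, B, B] :=
    Nat.le_add_left _ _
  rcases h0 : P 0 <;> rcases h1 : P 1 <;> rcases h2 : P 2
  · exact key 1 _ (by ext i : 1; fin_cases i <;> simp [h0, h1, h2]) hB
  · exact key (Equiv.swap 0 2) _ (by
      ext i : 1; fin_cases i <;> simp [h0, h1, h2, Equiv.swap_apply_def]) hY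
  · exact key (Equiv.swap 0 1) _ (by
      ext i : 1; fin_cases i <;> simp [h0, h1, h2, Equiv.swap_apply_def]) hY
  · exact key (Equiv.swap 0 2) _ (by
      ext i : 1; fin_cases i <;> simp [h0, h1, h2, Equiv.swap_apply_def]) hX
  · exact key 1 _ (by ext i : 1; fin_cases i <;> simp [h0, h1, h2]) hY
  · exact key (Equiv.swap 1 2) _ (by
      ext i : 1; fin_cases i <;> simp [h0, h1, h2, Equiv.swap_apply_def]) hX
  · exact key 1 _ (by ext i : 1; fin_cases i <;> simp [h0, h1, h2]) hX
  · exact key 1 _ (by ext i : 1; fin_cases i <;> simp [h0, h1, h2]) hA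

-- Colour a triple by which entries lie in `A`. The 8 patterns enter twice, giving 64: once as the
-- Cauchy–Schwarz loss, once in the sum over patterns.
open scoped Classical in
theorem mixedEnergy_union_le (A B : Finset G) :
    mixedEnergy (fun _ => A ∪ B) ≤ 64 * (mixedEnergy (fun _ => A) + mixedEnergy fun _ => B) := by
  have h := coincidences_le_card_mul (Fintype.piFinset fun _ : Fin 3 => A ∪ B)
    (fun x => ∑ i, x i) (fun x i => decide (x i ∈ A)) univ fun _ _ => mem_univ _
  have hA : (fun _ : Fin 3 => A) = ![A, A, A] := by ext i : 1; fin_cases i <;> rfl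
  have hB : (fun _ : Fin 3 => B) = ![B, B, B] := by ext i : 1; fin_cases i <;> rfl
  rw [hA, hB]
  have h' : coincidences (Fintype.piFinset fun _ : Fin 3 => A ∪ B)
      (fun x => (∑ i, x i, fun i => decide (x i ∈ A))) (Fintype.piFinset fun _ : Fin 3 => A ∪ B)
      (fun x => (∑ i, x i, fun i => decide (x i ∈ A))) ≤
      ∑ P : Fin 3 → Bool, mixedEnergy (fun i => if P i then A else B) := by
    unfold coincidences
    rw [card_eq_sum_card_fiberwise (t := univ)
      (f := fun p : (Fin 3 → G) × (Fin 3 → G) => fun i => decide (p.1 i ∈ A))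
      fun _ _ => mem_coe.2 (mem_univ _)]
    refine sum_le_sum fun P _ => card_le_card ?_
    rintro ⟨x, y⟩ hp
    simp only [mem_filter, mem_product, Fintype.mem_piFinset, Prod.mk.injEq, mem_union] at hp ⊢
    obtain ⟨⟨⟨hx, hy⟩, hs, hc⟩, hP⟩ := hp
    refine ⟨⟨fun i => ?_, fun i => ?_⟩, hs⟩
    · have := congrFun hP i
      have := hx i
      by_cases hi : x i ∈ A <;> simp_all
    · have := congrFun (hc.symm.trans hP) i
      have := hy i
      by_cases hi : y i ∈ A <;> simp_all
  have h'' := h'.trans (sum_le_card_nsmul _ _ _ fun P _ => mixedEnergy_ite_le A B P)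
  have hc : #(univ : Finset (Fin 3 → Bool)) = 8 := by simp
  rw [hc] at h h''
  calc mixedEnergy (fun _ => A ∪ B) ≤ _ := h
    _ ≤ _ := Nat.mul_le_mul_left _ h''
    _ = _ := by rw [smul_eq_mul]; ring

end MixedEnergy

/-! ### Majorization and chords for strictly convex functions -/

section Convex

variable {I : Set ℝ} {f : ℝ → ℝ}

theorem add_lt_add_of_strictConvexOn (hf : StrictConvexOn ℝ I f) {a b c d : ℝ} (ha : a ∈ I)
    (hb : b ∈ I) (hac : a < c) (hcb : c < b) (h : c + d = a + b) : f c + f d < f a + f b := by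
  have hab : a < b := hac.trans hcb
  have hpos : 0 < b - a := sub_pos.2 hab
  have hl : 0 < (b - c) / (b - a) := div_pos (by linarith) hpos
  have hr : 0 < (c - a) / (b - a) := div_pos (by linarith) hpos
  have hlr : (b - c) / (b - a) + (c - a) / (b - a) = 1 := by field_simp; ring
  have h₁ := hf.2 ha hb hab.ne hl hr hlr
  have h₂ := hf.2 ha hb hab.ne hr hl ((add_comm _ _).trans hlr)
  have e₁ : ((b - c) / (b - a)) • a + ((c - a) / (b - a)) • b = c := by
    simp only [smul_eq_mul]; field_simp; ring
  have e₂ : ((c - a) / (b - a)) • a + ((b - c) / (b - a)) • b = d := by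
    obtain rfl : d = a + b - c := by linarith
    simp only [smul_eq_mul]; field_simp; ring
  have e₃ : ((b - c) / (b - a)) • f a + ((c - a) / (b - a)) • f b +
      (((c - a) / (b - a)) • f a + ((b - c) / (b - a)) • f b) = f a + f b := by
    simp only [smul_eq_mul]; field_simp; ring
  rw [e₁] at h₁
  rw [e₂] at h₂
  linarith

/-- A triple is determined by its sum and the sum of a strictly convex function over it among the
triples that it majorizes. -/
theorem eq_of_majorizes (hf : StrictConvexOn ℝ I f) {s u t s' u' t' : ℝ} (hs : s ∈ I) (hu : u ∈ I)
    (ht : t ∈ I) (hsu' : s' ≤ u') (hut' : u' ≤ t')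
    (hsum : s + u + t = s' + u' + t') (hfsum : f s + f u + f t = f s' + f u' + f t')
    (hss : s ≤ s') (htt : t' ≤ t) : s = s' ∧ t = t' := by
  by_contra hne
  have hst : s < t := by
    by_contra! h
    exact hne ⟨by linarith, by linarith⟩
  have hI : ∀ x, s ≤ x → x ≤ t → x ∈ I := fun x h₁ h₂ =>
    hf.1.ordConnected.out hs ht ⟨h₁, h₂⟩
  -- Move both ends inward by the smaller gap, then transfer the rest of the larger gap to `u`.
  -- Neither move raises the `f`-sum, and at least one lowers it strictly.
  rcases le_total (t - t') (s' - s) with h | h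
  · have h₁ : f (s + (t - t')) + f t' ≤ f s + f t := by
      rcases htt.eq_or_lt with rfl | hlt
      · simp
      · exact (add_lt_add_of_strictConvexOn hf hs ht (by linarith) (by linarith) (by ring)).le
    rcases h.eq_or_lt with he | hlt
    · have hs' : s + (t - t') = s' := by linarith
      have hu' : u = u' := by linarith
      have hlt : s < s' := by
        refine lt_of_le_of_ne hss fun h0 => hne ⟨h0, by linarith⟩
      have := add_lt_add_of_strictConvexOn hf hs ht (c := s') (d := t') hlt (by linarith)
        (by linarith)
      subst hu'
      linarith
    · have := add_lt_add_of_strictConvexOn hf (hI (s + (t - t')) (by linarith) (by linarith)) hu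
        (c := s') (d := u') (by linarith) (by linarith) (by linarith)
      linarith
  · have h₁ : f s' + f (t - (s' - s)) ≤ f s + f t := by
      rcases hss.eq_or_lt with rfl | hlt
      · simp
      · exact (add_lt_add_of_strictConvexOn hf hs ht hlt (by linarith) (by ring)).le
    rcases h.eq_or_lt with he | hlt
    · have ht' : t - (s' - s) = t' := by linarith
      have hu' : u = u' := by linarith
      have hlt : s < s' := by
        refine lt_of_le_of_ne hss fun h0 => hne ⟨h0, by linarith⟩
      have := add_lt_add_of_strictConvexOn hf hs ht (c := s') (d := t') hlt (by linarith)
        (by linarith)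
      subst hu'
      linarith
    · have := add_lt_add_of_strictConvexOn hf hu (hI (t - (s' - s)) (by linarith) (by linarith))
        (c := t') (d := u') (by linarith) (by linarith) (by linarith)
      linarith

/-- A chord with given nonzero displacement of a strictly convex graph is unique. -/
theorem eq_of_sub_eq_sub (hf : StrictConvexOn ℝ I f) {u u' v v' : ℝ} (hu : u ∈ I) (hu' : u' ∈ I)
    (hv : v ∈ I) (hv' : v' ∈ I) (hne : u ≠ u') (h : u - u' = v - v')
    (hfe : f u - f u' = f v - f v') : u = v := by
  have key : ∀ {a a' b b' : ℝ}, a ∈ I → a' ∈ I → b ∈ I → b' ∈ I → a' < a → a - a' = b - b' →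
      f a - f a' = f b - f b' → ¬ a < b := by
    intro a a' b b' _ ha' hb _ hlt h hfe hab
    have := add_lt_add_of_strictConvexOn hf ha' hb (c := a) (d := b') hlt hab (by linarith)
    linarith
  rcases hne.lt_or_gt with hlt | hlt
  · refine le_antisymm ?_ ?_ <;> by_contra! hc
    · exact key hv' hv hu' hu (by linarith) (by linarith) (by linarith) (by linarith)
    · exact key hu' hu hv' hv (by linarith) (by linarith) (by linarith) (by linarith)
  · refine le_antisymm ?_ ?_ <;> by_contra! hc
    · exact key hv hv' hu hu' (by linarith) (by linarith) (by linarith) hc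
    · exact key hu hu' hv hv' (by linarith) (by linarith) (by linarith) hc

theorem ends_eq_or_lt (hf : StrictConvexOn ℝ I f) {x y : Fin 3 → ℝ} (hx : ∀ i, x i ∈ I)
    (hy : ∀ i, y i ∈ I) (hxm : Monotone x) (hym : Monotone y) (hsum : ∑ i, x i = ∑ i, y i)
    (hfsum : ∑ i, f (x i) = ∑ i, f (y i)) :
    x = y ∨ (x 0 < y 0 ∧ x 2 < y 2) ∨ (y 0 < x 0 ∧ y 2 < x 2) := by
  rw [Fin.sum_univ_three, Fin.sum_univ_three] at hsum hfsum
  have hext : x 0 = y 0 ∧ x 2 = y 2 → x = y := by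
    rintro ⟨h0, h2⟩
    ext i
    fin_cases i
    · exact h0
    · change x 1 = y 1; linarith
    · exact h2
  have hx01 : x 0 ≤ x 1 := hxm (by decide)
  have hx12 : x 1 ≤ x 2 := hxm (by decide)
  have hy01 : y 0 ≤ y 1 := hym (by decide)
  have hy12 : y 1 ≤ y 2 := hym (by decide)
  rcases le_or_gt (x 0) (y 0) with h0 | h0
  · rcases le_or_gt (y 2) (x 2) with h2 | h2
    · exact Or.inl (hext (eq_of_majorizes hf (hx 0) (hx 1) (hx 2) hy01 hy12 hsum hfsum h0 h2))
    · rcases h0.eq_or_lt with he | hlt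
      · refine Or.inl (hext ?_)
        have := eq_of_majorizes hf (hy 0) (hy 1) (hy 2) hx01 hx12 hsum.symm hfsum.symm he.ge h2.le
        exact ⟨this.1.symm, this.2.symm⟩
      · exact Or.inr (Or.inl ⟨hlt, h2⟩)
  · rcases le_or_gt (x 2) (y 2) with h2 | h2
    · refine Or.inl (hext ?_)
      have := eq_of_majorizes hf (hy 0) (hy 1) (hy 2) hx01 hx12 hsum.symm hfsum.symm h0.le h2
      exact ⟨this.1.symm, this.2.symm⟩
    · exact Or.inr (Or.inr ⟨h0, h2⟩)

end Convex

/-! ### Blocks of consecutive elements -/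

section Blocks

/-- The index of the block containing `a` when `A` is cut, in increasing order, into blocks of
`q` consecutive elements. -/
noncomputable def block (A : Finset ℝ) (q : ℕ) (a : ℝ) : ℕ := #{b ∈ A | b < a} / q

theorem block_mono (A : Finset ℝ) (q : ℕ) : Monotone (block A q) := fun a b hab =>
  Nat.div_le_div_right (card_le_card fun c hc => by
    rw [mem_filter] at hc ⊢
    exact ⟨hc.1, hc.2.trans_le hab⟩)

theorem block_le (A : Finset ℝ) (q : ℕ) (a : ℝ) : block A q a ≤ #A / q :=
  Nat.div_le_div_right (card_filter_le _ _)

theorem card_block_le (A : Finset ℝ) {q : ℕ} (hq : 0 < q) (k : ℕ) :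
    #{a ∈ A | block A q a = k} ≤ q := by
  have hinj : Set.InjOn (fun a : ℝ => #{b ∈ A | b < a}) A := by
    have hlt : ∀ a ∈ A, ∀ b, a < b → #{c ∈ A | c < a} < #{c ∈ A | c < b} := by
      intro a ha b hab
      refine card_lt_card ⟨fun c hc => ?_, fun h => ?_⟩
      · rw [mem_filter] at hc ⊢
        exact ⟨hc.1, hc.2.trans hab⟩
      · exact lt_irrefl a (mem_filter.1 (h (mem_filter.2 ⟨ha, hab⟩))).2
    intro a ha b hb h
    rcases lt_trichotomy a b with hab | hab | hab
    · exact absurd h (hlt a ha b hab).ne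
    · exact hab
    · exact absurd h (hlt b hb a hab).ne'
  calc #{a ∈ A | block A q a = k} ≤ #(Ico (k * q) (k * q + q)) := by
        refine card_le_card_of_injOn (fun a : ℝ => #{b ∈ A | b < a}) ?_ ?_
        · intro a ha
          rw [mem_coe, mem_Ico, ← (mem_filter.1 ha).2]
          exact ⟨Nat.div_mul_le_self _ _, Nat.lt_div_mul_add hq⟩
        · exact hinj.mono fun a ha => (mem_filter.1 ha).1
    _ = q := by simp

theorem coincidences_block_le (A : Finset ℝ) {q : ℕ} (hq : 0 < q) :
    coincidences A (block A q) A (block A q) ≤ #A * q := by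
  classical
  rw [coincidences_eq_sum A _ A _ (A.image (block A q)) fun _ h => mem_image_of_mem _ h]
  rw [card_eq_sum_card_image (block A q) A, sum_mul]
  refine sum_le_sum fun x _ => ?_
  refine Nat.mul_le_mul (le_of_eq ?_) (le_of_eq_of_le ?_ (card_block_le A hq x)) <;> congr

end Blocks

/-! ### Energy of a strictly convex graph -/

section Graph

variable {I : Set ℝ} {f : ℝ → ℝ}

open scoped Classical in
/-- The nondecreasing triples of elements of `A`. -/
noncomputable def sortedTriples (A : Finset ℝ) : Finset (Fin 3 → ℝ) :=
  {x ∈ Fintype.piFinset fun _ => A | Monotone x}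

theorem mem_sortedTriples {A : Finset ℝ} {x : Fin 3 → ℝ} :
    x ∈ sortedTriples A ↔ (∀ i, x i ∈ A) ∧ Monotone x := by
  simp [sortedTriples]

/-- The sum over a triple of points of the graph of `f`, given by their abscissae. -/
noncomputable def graphSum (f : ℝ → ℝ) (x : Fin 3 → ℝ) : ℝ × ℝ := (∑ i, x i, ∑ i, f (x i))

theorem coincidences_sortedTriples_le (hf : StrictConvexOn ℝ I f) {A : Finset ℝ}
    (hA : ∀ a ∈ A, a ∈ I) {q : ℕ} (hq : 0 < q) :
    coincidences (sortedTriples A) (graphSum f) (sortedTriples A) (graphSum f) ≤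
      (2 * (#A / q) + 1) * (#A ^ 3 + (#A * q) ^ 2) := by
  classical
  have hcol := coincidences_le_card_mul (sortedTriples A) (graphSum f)
    (fun x => block A q (x 0) + block A q (x 2)) (range (2 * (#A / q) + 1)) fun x _ => by
      have h0 := block_le A q (x 0)
      have h2 := block_le A q (x 2)
      rw [mem_range]
      omega
  rw [card_range] at hcol
  refine hcol.trans (Nat.mul_le_mul_left _ ?_)
  unfold coincidences
  -- Diagonal pairs give `#A ^ 3`; the others are encoded by their four ends.
  rw [← card_filter_add_card_filter_not fun p : (Fin 3 → ℝ) × (Fin 3 → ℝ) => p.1 = p.2]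
  refine Nat.add_le_add ?_ ?_
  · calc _ ≤ #(Fintype.piFinset fun _ : Fin 3 => A) := by
          refine card_le_card_of_injOn Prod.fst ?_ ?_
          · rintro ⟨x, y⟩ h
            simp only [coe_filter, mem_filter, mem_product, mem_sortedTriples,
              Set.mem_ofPred_eq] at h
            exact mem_coe.2 (Fintype.mem_piFinset.2 h.1.1.1.1)
          · rintro ⟨x, y⟩ h ⟨x', y'⟩ h' e
            have h₁ : x = y := (mem_filter.1 h).2
            have h₂ : x' = y' := (mem_filter.1 h').2
            have h₃ : x = x' := e
            rw [← h₁, ← h₂, h₃]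
      _ = #A ^ 3 := by simp
  · have hchain : ∀ x y : Fin 3 → ℝ, x ∈ sortedTriples A → y ∈ sortedTriples A →
        graphSum f x = graphSum f y → x ≠ y →
        (x 0 < y 0 ∧ x 2 < y 2) ∨ (y 0 < x 0 ∧ y 2 < x 2) := by
      intro x y hx hy hs hne
      rw [mem_sortedTriples] at hx hy
      simp only [graphSum, Prod.mk.injEq] at hs
      exact (ends_eq_or_lt hf (fun i => hA _ (hx.1 i)) (fun i => hA _ (hy.1 i)) hx.2 hy.2
        hs.1 hs.2).resolve_left hne
    have hmono := block_mono A q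
    calc _ ≤ #({p ∈ A ×ˢ A | block A q p.1 = block A q p.2} ×ˢ
          {p ∈ A ×ˢ A | block A q p.1 = block A q p.2}) := by
          refine card_le_card_of_injOn
            (fun p => ((p.1 0, p.2 0), (p.1 2, p.2 2))) ?_ ?_
          · rintro ⟨x, y⟩ h
            simp only [coe_filter, mem_filter, mem_product, Set.mem_ofPred_eq,
              Prod.mk.injEq] at h
            obtain ⟨⟨⟨hx, hy⟩, hs, hb⟩, hne⟩ := h
            have hx' := (mem_sortedTriples.1 hx).1
            have hy' := (mem_sortedTriples.1 hy).1
            have hb' : block A q (x 0) = block A q (y 0) ∧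
                block A q (x 2) = block A q (y 2) := by
              -- Two indices that change in the same direction with fixed sum are both unchanged.
              rcases hchain x y hx hy hs hne with ⟨h0, h2⟩ | ⟨h0, h2⟩
              · have := hmono h0.le
                have := hmono h2.le
                omega
              · have := hmono h0.le
                have := hmono h2.le
                omega
            simp only [mem_coe, mem_filter, mem_product]
            exact ⟨⟨⟨hx' 0, hy' 0⟩, hb'.1⟩, ⟨hx' 2, hy' 2⟩, hb'.2⟩
          · rintro ⟨x, y⟩ h ⟨x', y'⟩ h' e
            simp only [coe_filter, mem_filter, mem_product, Set.mem_ofPred_eq,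
              Prod.mk.injEq] at h h' e
            obtain ⟨⟨⟨hx, hy⟩, hs, -⟩, hne⟩ := h
            obtain ⟨⟨⟨hx', hy'⟩, hs', -⟩, -⟩ := h'
            obtain ⟨⟨e₁, e₂⟩, e₃, e₄⟩ := e
            have hends := hchain x y hx hy hs hne
            have mI : ∀ z ∈ sortedTriples A, z 1 ∈ I := fun z hz =>
              hA _ ((mem_sortedTriples.1 hz).1 1)
            simp only [graphSum, Prod.mk.injEq, Fin.sum_univ_three] at hs hs'
            rw [← e₁, ← e₂, ← e₃, ← e₄] at hs'
            have hxx : x 1 = x' 1 := by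
              refine eq_of_sub_eq_sub hf (mI x hx) (mI y hy) (mI x' hx') (mI y' hy') ?_
                (by linarith [hs.1, hs'.1]) (by linarith [hs.2, hs'.2])
              -- Equal middles would leave ends with equal sums, yet both ends move the same way.
              intro h1
              rcases hends with ⟨h0, h2⟩ | ⟨h0, h2⟩ <;> linarith [hs.1]
            have hyy : y 1 = y' 1 := by linarith [hs.1, hs'.1]
            rw [Prod.mk.injEq]
            constructor <;> ext i <;> fin_cases i <;> assumption
      _ ≤ (#A * q) ^ 2 := by
          rw [card_product, ← sq]
          refine Nat.pow_le_pow_left (le_of_eq_of_le ?_ (coincidences_block_le A hq)) 2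
          unfold coincidences
          congr

/-- A pair is recovered from its sorted forms and the two sorting permutations, whence 36 = (3!)².
-/
theorem coincidences_triples_le (f : ℝ → ℝ) (A : Finset ℝ) :
    coincidences (Fintype.piFinset fun _ : Fin 3 => A) (graphSum f)
      (Fintype.piFinset fun _ : Fin 3 => A) (graphSum f) ≤
      36 * coincidences (sortedTriples A) (graphSum f) (sortedTriples A) (graphSum f) := by
  classical
  have hc : #(univ : Finset (Equiv.Perm (Fin 3) × Equiv.Perm (Fin 3))) = 36 := by
    rw [card_univ, Fintype.card_prod, Fintype.card_perm, Fintype.card_fin]; rfl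
  unfold coincidences
  rw [← hc, ← card_product]
  refine card_le_card_of_injOn (fun p =>
    ((Tuple.sort p.1, Tuple.sort p.2), (p.1 ∘ Tuple.sort p.1, p.2 ∘ Tuple.sort p.2))) ?_ ?_
  · rintro ⟨x, y⟩ h
    simp only [coe_filter, mem_product, Fintype.mem_piFinset, Set.mem_ofPred_eq] at h
    simp only [mem_coe, mem_product, mem_univ, true_and, mem_filter, mem_sortedTriples]
    refine ⟨⟨⟨fun i => h.1.1 _, Tuple.monotone_sort x⟩, fun i => h.1.2 _,
      Tuple.monotone_sort y⟩, ?_⟩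
    have hg : ∀ (z : Fin 3 → ℝ) (σ : Equiv.Perm (Fin 3)),
        graphSum f (z ∘ σ) = graphSum f z := fun z σ => by
      simp only [graphSum, Function.comp_apply]
      rw [Equiv.sum_comp σ z, Equiv.sum_comp σ fun i => f (z i)]
    rw [hg, hg, h.2]
  · rintro ⟨x, y⟩ - ⟨x', y'⟩ - h
    simp only [Prod.mk.injEq] at h ⊢
    obtain ⟨⟨h₁, h₂⟩, h₃, h₄⟩ := h
    rw [← h₁] at h₃
    rw [← h₂] at h₄
    exact ⟨(Tuple.sort x).surjective.injective_comp_right h₃,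
      (Tuple.sort y).surjective.injective_comp_right h₄⟩

theorem coincidences_triples_le_rpow (hf : StrictConvexOn ℝ I f) {A : Finset ℝ}
    (hA : ∀ a ∈ A, a ∈ I) :
    (coincidences (Fintype.piFinset fun _ : Fin 3 => A) (graphSum f)
      (Fintype.piFinset fun _ : Fin 3 => A) (graphSum f) : ℝ) ≤
      540 * (#A : ℝ) ^ (7 / 2 : ℝ) := by
  rcases A.eq_empty_or_nonempty with rfl | hne
  · simp [coincidences]
  have hN : (1 : ℝ) ≤ #A := by exact_mod_cast hne.card_pos
  -- Block length ⌊√N⌋ + 1 lies between √N and 2√N, which balances colours against block size.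
  have h := (coincidences_triples_le f A).trans (Nat.mul_le_mul_left 36
    (coincidences_sortedTriples_le hf hA (q := Nat.sqrt #A + 1) (Nat.succ_pos _)))
  have h' : (coincidences (Fintype.piFinset fun _ : Fin 3 => A) (graphSum f)
      (Fintype.piFinset fun _ : Fin 3 => A) (graphSum f) : ℝ) ≤
      36 * ((2 * ((#A / (Nat.sqrt #A + 1) : ℕ) : ℝ) + 1) *
        ((#A : ℝ) ^ 3 + ((#A : ℝ) * ((Nat.sqrt #A : ℝ) + 1)) ^ 2)) := by exact_mod_cast h
  set r := √(#A : ℝ) with hr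
  have hr2 : r ^ 2 = #A := Real.sq_sqrt (by linarith)
  have hr1 : 1 ≤ r := Real.one_le_sqrt.2 hN
  have hq : (Nat.sqrt #A : ℝ) ≤ r := Real.nat_sqrt_le_real_sqrt
  have hq' : r ≤ (Nat.sqrt #A : ℝ) + 1 := Real.real_sqrt_le_nat_sqrt_succ
  have hd : ((#A / (Nat.sqrt #A + 1) : ℕ) : ℝ) ≤ r := by
    refine Nat.cast_div_le.trans ?_
    push_cast
    rw [div_le_iff₀ (by linarith), ← hr2]
    nlinarith
  have hpow : (#A : ℝ) ^ (7 / 2 : ℝ) = r ^ 7 := by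
    rw [hr, Real.sqrt_eq_rpow, ← Real.rpow_natCast, ← Real.rpow_mul (by linarith)]
    norm_num
  rw [hpow]
  refine h'.trans ?_
  have h₁ : (2 * ((#A / (Nat.sqrt #A + 1) : ℕ) : ℝ) + 1) ≤ 3 * r := by linarith
  have h₂ : ((#A : ℝ) ^ 3 + ((#A : ℝ) * ((Nat.sqrt #A : ℝ) + 1)) ^ 2) ≤ 5 * r ^ 6 := by
    have : (#A : ℝ) * ((Nat.sqrt #A : ℝ) + 1) ≤ r ^ 2 * (2 * r) := by
      rw [hr2]
      exact mul_le_mul_of_nonneg_left (by linarith) (by linarith)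
    have h3 : ((#A : ℝ) * ((Nat.sqrt #A : ℝ) + 1)) ^ 2 ≤ (r ^ 2 * (2 * r)) ^ 2 :=
      pow_le_pow_left₀ (by positivity) this 2
    calc _ ≤ (r ^ 2) ^ 3 + (r ^ 2 * (2 * r)) ^ 2 := by rw [hr2] at h3 ⊢; linarith
      _ = 5 * r ^ 6 := by ring
  calc _ ≤ 36 * ((3 * r) * (5 * r ^ 6)) := by gcongr
    _ = 540 * r ^ 7 := by ring

/-- The energy bound on the graph of a multiple of a strictly convex function. -/
theorem mixedEnergy_graph_le (hf : StrictConvexOn ℝ I f) {c : ℝ} (hc : c ≠ 0)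
    {Λ : Finset (EuclideanSpace ℝ (Fin 2))} (h0 : ∀ x ∈ Λ, x 0 ∈ I)
    (h1 : ∀ x ∈ Λ, x 1 = c * f (x 0)) :
    (mixedEnergy (fun _ => Λ) : ℝ) ≤ 540 * (#Λ : ℝ) ^ (7 / 2 : ℝ) := by
  classical
  have hA : ∀ a ∈ Λ.image (fun x => x 0), a ∈ I := by
    intro a ha
    obtain ⟨x, hx, rfl⟩ := mem_image.1 ha
    exact h0 x hx
  have hle : mixedEnergy (fun _ => Λ) ≤
      coincidences (Fintype.piFinset fun _ : Fin 3 => Λ.image fun x => x 0) (graphSum f)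
        (Fintype.piFinset fun _ : Fin 3 => Λ.image fun x => x 0) (graphSum f) := by
    refine card_le_card_of_injOn (fun p => (fun i => p.1 i 0, fun i => p.2 i 0)) ?_ ?_
    · rintro ⟨x, y⟩ h
      simp only [coe_filter, mem_product, Fintype.mem_piFinset, Set.mem_ofPred_eq] at h ⊢
      obtain ⟨⟨hx, hy⟩, hs⟩ := h
      refine ⟨⟨fun i => mem_image_of_mem _ (hx i), fun i => mem_image_of_mem _ (hy i)⟩, ?_⟩
      have hs0 := congrArg (fun v : EuclideanSpace ℝ (Fin 2) => v 0) hs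
      have hs1 := congrArg (fun v : EuclideanSpace ℝ (Fin 2) => v 1) hs
      simp only [Fin.sum_univ_three, PiLp.add_apply] at hs0 hs1
      simp only [graphSum, Fin.sum_univ_three, Prod.mk.injEq]
      refine ⟨hs0, mul_left_cancel₀ hc ?_⟩
      simp only [h1 _ (hx _), h1 _ (hy _)] at hs1
      linarith
    · have hinj : ∀ v ∈ Λ, ∀ w ∈ Λ, v 0 = w 0 → v = w := by
        intro v hv w hw h
        ext i
        fin_cases i
        · exact h
        · change v 1 = w 1
          rw [h1 v hv, h1 w hw, h]
      rintro ⟨x, y⟩ h ⟨x', y'⟩ h' e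
      simp only [coe_filter, mem_product, Fintype.mem_piFinset, Set.mem_ofPred_eq] at h h'
      simp only [Prod.mk.injEq] at e ⊢
      exact ⟨funext fun i => hinj _ (h.1.1 i) _ (h'.1.1 i) (congrFun e.1 i),
        funext fun i => hinj _ (h.1.2 i) _ (h'.1.2 i) (congrFun e.2 i)⟩
  calc (mixedEnergy (fun _ => Λ) : ℝ) ≤ _ := by exact_mod_cast hle
    _ ≤ _ := coincidences_triples_le_rpow hf hA
    _ ≤ _ := by
      gcongr
      exact card_image_le

end Graph

/-! ### The parabola and the circle -/

theorem kEnergy_three (Λ : Finset (EuclideanSpace ℝ (Fin 2))) :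
    kEnergy 3 Λ = mixedEnergy fun _ => Λ := by
  classical
  unfold kEnergy mixedEnergy coincidences
  rw [← Set.ncard_coe_finset]
  congr 1
  ext p
  simp [and_assoc]

theorem strictConvexOn_neg_sqrt_one_sub_sq :
    StrictConvexOn ℝ (Set.Icc (-1) 1) fun x : ℝ => -√(1 - x ^ 2) := by
  refine ⟨convex_Icc _ _, fun x hx y hy hxy a b ha hb hab => ?_⟩
  have hx2 : 0 ≤ 1 - x ^ 2 := by nlinarith [hx.1, hx.2]
  have hy2 : 0 ≤ 1 - y ^ 2 := by nlinarith [hy.1, hy.2]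
  have h₁ := Real.strictConcaveOn_sqrt.concaveOn.2 hx2 hy2 ha.le hb.le hab
  have h₂ := (even_two.strictConvexOn_pow two_ne_zero).2 (Set.mem_univ x) (Set.mem_univ y) hxy
    ha hb hab
  simp only [smul_eq_mul] at h₁ h₂ ⊢
  have h₃ : √(a * (1 - x ^ 2) + b * (1 - y ^ 2)) < √(1 - (a * x + b * y) ^ 2) :=
    Real.sqrt_lt_sqrt (by positivity) (by linarith)
  linarith

theorem kEnergy_three_le_of_parabola {Λ : Finset (EuclideanSpace ℝ (Fin 2))}
    (h : (Λ : Set _) ⊆ truncatedParabola) :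
    (kEnergy 3 Λ : ℝ) ≤ 540 * (#Λ : ℝ) ^ (7 / 2 : ℝ) := by
  rw [kEnergy_three]
  exact mixedEnergy_graph_le (even_two.strictConvexOn_pow two_ne_zero) one_ne_zero
    (fun _ _ => Set.mem_univ _) fun x hx => by rw [one_mul]; exact (h hx).2

theorem kEnergy_three_le_of_circle {Λ : Finset (EuclideanSpace ℝ (Fin 2))}
    (h : (Λ : Set _) ⊆ unitCircle) :
    (kEnergy 3 Λ : ℝ) ≤ 69120 * (#Λ : ℝ) ^ (7 / 2 : ℝ) := by
  classical
  have hc : ∀ x ∈ Λ, x 0 ^ 2 + x 1 ^ 2 = 1 := by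
    intro x hx
    have hx' : ‖x‖ = 1 := by simpa [unitCircle] using h hx
    have := EuclideanSpace.real_norm_sq_eq x
    rw [hx', Fin.sum_univ_two] at this
    linarith
  have hI : ∀ x ∈ Λ, x 0 ∈ Set.Icc (-1 : ℝ) 1 := fun x hx =>
    abs_le.1 ((sq_le_one_iff_abs_le_one _).1 (by nlinarith [hc x hx]))
  have hlow := mixedEnergy_graph_le (Λ := {x ∈ Λ | x 1 ≤ 0}) strictConvexOn_neg_sqrt_one_sub_sq
    one_ne_zero (fun x hx => hI x (mem_filter.1 hx).1) fun x hx => by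
      rw [mem_filter] at hx
      rw [show 1 - x 0 ^ 2 = (-x 1) ^ 2 by linarith [hc x hx.1],
        Real.sqrt_sq (by linarith [hx.2])]
      ring
  have hup := mixedEnergy_graph_le (Λ := {x ∈ Λ | ¬ x 1 ≤ 0}) strictConvexOn_neg_sqrt_one_sub_sq
    (neg_ne_zero.2 one_ne_zero) (fun x hx => hI x (mem_filter.1 hx).1) fun x hx => by
      rw [mem_filter] at hx
      rw [show 1 - x 0 ^ 2 = (x 1) ^ 2 by linarith [hc x hx.1],
        Real.sqrt_sq (by linarith [hx.2])]
      ring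
  have hun := mixedEnergy_union_le {x ∈ Λ | x 1 ≤ 0} {x ∈ Λ | ¬ x 1 ≤ 0}
  rw [filter_union_filter_not_eq, ← kEnergy_three] at hun
  have hun' : (kEnergy 3 Λ : ℝ) ≤ 64 * ((mixedEnergy fun _ => {x ∈ Λ | x 1 ≤ 0} : ℕ) +
      (mixedEnergy fun _ => {x ∈ Λ | ¬ x 1 ≤ 0} : ℕ)) := by exact_mod_cast hun
  have hm : ∀ B ⊆ Λ, (#B : ℝ) ^ (7 / 2 : ℝ) ≤ (#Λ : ℝ) ^ (7 / 2 : ℝ) := fun B hB => by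
    have := card_le_card hB
    gcongr
  -- 69120 = 64 · 2 · 540: each of the two arcs is bounded by the size of all of `Λ`.
  linarith [hm _ (filter_subset (fun x => x 1 ≤ 0) Λ), hm _ (filter_subset (fun x => ¬ x 1 ≤ 0) Λ)]

end ThreeEnergy

theorem mainTheorem5 (S : Set (EuclideanSpace ℝ (Fin 2)))
    (hS : S = truncatedParabola ∨ S = unitCircle) (ε : ℝ) (hε : 0 < ε) :
    ∃ C : ℝ, 0 < C ∧ ∀ Λ : Finset (EuclideanSpace ℝ (Fin 2)), (Λ : Set _) ⊆ S →
      (kEnergy 3 Λ : ℝ) ≤ C * (Λ.card : ℝ) ^ (7 / 2 + ε) := by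
  refine ⟨69120, by norm_num, fun Λ hΛ => ?_⟩
  have hle : (kEnergy 3 Λ : ℝ) ≤ 69120 * (Λ.card : ℝ) ^ (7 / 2 : ℝ) := by
    rcases hS with rfl | rfl
    · refine (ThreeEnergy.kEnergy_three_le_of_parabola hΛ).trans ?_
      gcongr
      norm_num
    · exact ThreeEnergy.kEnergy_three_le_of_circle hΛ
  refine hle.trans (mul_le_mul_of_nonneg_left ?_ (by norm_num))
  -- Monotonicity in the exponent needs base at least 1, so the empty set is separate.
  rcases Λ.eq_empty_or_nonempty with rfl | hne
  · simp only [Finset.card_empty, Nat.cast_zero]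
    rw [Real.zero_rpow (by norm_num), Real.zero_rpow (by positivity)]
  · exact Real.rpow_le_rpow_of_exponent_le (by exact_mod_cast hne.card_pos) (by linarith)
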